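/- Let $n\ge 0$. Let $B_n^+$ be the monoid generated by the symbols $a_{ts}$ with $n\ge t>s\ge 1$, subject to the relations $a_{ts}a_{rq}=a_{rq}a_{ts}$ whenever $(t-r)(t-q)(s-r)(s-q)>0$, and $a_{ts}a_{sr}=a_{tr}a_{ts}=a_{sr}a_{tr}$ for all $n\ge t>s>r\ge 1$. A positive word is a (possibly empty) word in the generators $a_{ts}$, and $X\doteq Y$ means that the positive word $X$ can be transformed into the positive word $Y$ by finitely many (possibly zero) direct applications of the defining relations to subwords, in either direction; thus $B_n^+$ is the set of positive words modulo $\doteq$. **Theorem (Left "cancellation").** Let $n\ge t>s\ge 1$ and $n\ge r>q\ge 1$, and let $X,Y$ be positive words with $a_{ts}X\doteq a_{rq}Y$. Then: (I) If $t=r$ and $s=q$, then $X\doteq Y$. (II) (three distinct indices) - (i) If $t=r$ and $q<s$, then $X\doteq a_{sq}Z$ and $Y\doteq a_{ts}Z$ for some positive word $Z$. - (ii) If $t=r$ and $s<q$, then $X\doteq a_{tq}Z$ and $Y\doteq a_{qs}Z$ for some positive word $Z$. - (iii) If $t=q$, then $X\doteq a_{rs}Z$ and $Y\doteq a_{ts}Z$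 for some positive word $Z$. - (iv) If $s=r$, then $X\doteq a_{sq}Z$ and $Y\doteq a_{tq}Z$ for some positive word $Z$. - (v) If $s=q$ and $r<t$, then $X\doteq a_{tr}Z$ and $Y\doteq a_{ts}Z$ for some positive word $Z$. - (vi) If $s=q$ and $t<r$, then $X\doteq a_{rs}Z$ and $Y\doteq a_{rt}Z$ for some positive word $Z$. (III) If $(t-r)(t-q)(s-r)(s-q)>0$ (so that the four indices are distinct), then $X\doteq a_{rq}Z$ and $Y\doteq a_{ts}Z$ for some positive word $Z$. (IV) (four distinct indices) - (i) If $q<s<r<t$, then $X\doteq a_{tr}a_{sq}Z$ and $Y\doteq a_{tq}a_{rs}Z$ for some positive word $Z$. - (ii) If $s<q<t<r$, then $X\doteq a_{tq}a_{rs}Z$ and $Y\doteq a_{rt}a_{qs}Z$ for some positive word $Z$. In particular, the monoid $B_n^+$ is left cancellative: if $PX=PY$ in $B_n^+$, then $X=Y$ in $B_n^+$. -/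

import Mathlib

namespace BandBraid

/-- The band generators `a_{ts}` on `n` strands: pairs of strands `s < t`. The strands
`1, …, n` are indexed by `Fin n`; only their order matters. -/
structure Gen (n : ℕ) where
  /-- the first subscript -/
  t : Fin n
  /-- the second subscript -/
  s : Fin n
  lt : s < t

/-- Positive words: words in positive powers of the band generators. -/
abbrev PosWord (n : ℕ) : Type := FreeMonoid (Gen n)

/-- The one-letter positive word `a_{ts}`. -/
def band {n : ℕ} (t s : Fin n) (h : s < t) : PosWord n := FreeMonoid.of ⟨t, s, h⟩

/-- The defining relations. The last three constructors are the three equations contained in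
`a_{ts} a_{sr} = a_{tr} a_{ts} = a_{sr} a_{tr}`, for `t > s > r`. -/
inductive BandRel (n : ℕ) : PosWord n → PosWord n → Prop
  | comm (t s r q : Fin n) (hst : s < t) (hqr : q < r)
      (h : 0 < ((t.val : ℤ) - r.val) * ((t.val : ℤ) - q.val) *
        ((s.val : ℤ) - r.val) * ((s.val : ℤ) - q.val)) :
      BandRel n (band t s hst * band r q hqr) (band r q hqr * band t s hst)
  | tri₁₂ (t s r : Fin n) (hst : s < t) (hrs : r < s) :
      BandRel n (band t s hst * band s r hrs) (band t r (hrs.trans hst) * band t s hst)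
  | tri₂₃ (t s r : Fin n) (hst : s < t) (hrs : r < s) :
      BandRel n (band t r (hrs.trans hst) * band t s hst) (band s r hrs * band t r (hrs.trans hst))
  | tri₁₃ (t s r : Fin n) (hst : s < t) (hrs : r < s) :
      BandRel n (band t s hst * band s r hrs) (band s r hrs * band t r (hrs.trans hst))

/-- `W'` is obtained from `W` by a single direct application of a defining relation, in
either direction, to a subword. -/
def Step {n : ℕ} (W W' : PosWord n) : Prop :=
  ∃ P Q u v : PosWord n, (BandRel n u v ∨ BandRel n v u) ∧ W = P * u * Q ∧ W' = P * v * Q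

/-- Positive equivalence: one word is transformed into the other by a finite (possibly empty)
sequence of single applications of the defining relations. -/
def PosEquiv {n : ℕ} (X Y : PosWord n) : Prop := Relation.ReflTransGen Step X Y

infix:50 " ≐ " => PosEquiv

/-- The monoid `B_n^+` of positive braids, given by the band generators and the defining
relations. -/
abbrev PosBraidMonoid (n : ℕ) : Type := PresentedMonoid (BandRel n)

/-- `B_n^+` is the set of positive words modulo positive equivalence. -/
theorem mk_eq_mk_iff {n : ℕ} (X Y : PosWord n) :
    PresentedMonoid.mk (BandRel n) X = PresentedMonoid.mk (BandRel n) Y ↔ X ≐ Y := by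
  have hmulL : ∀ (P : PosWord n) {X Y : PosWord n}, X ≐ Y → P * X ≐ P * Y := by
    intro P X Y h
    refine Relation.ReflTransGen.lift (fun W => P * W) ?_ _ _ h
    rintro _ _ ⟨A, B, u, v, huv, rfl, rfl⟩
    exact ⟨P * A, B, u, v, huv, by simp only [mul_assoc], by simp only [mul_assoc]⟩
  have hmulR : ∀ (P : PosWord n) {X Y : PosWord n}, X ≐ Y → X * P ≐ Y * P := by
    intro P X Y h
    refine Relation.ReflTransGen.lift (fun W => W * P) ?_ _ _ h
    rintro _ _ ⟨A, B, u, v, huv, rfl, rfl⟩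
    exact ⟨A, B * P, u, v, huv, by simp only [mul_assoc], by simp only [mul_assoc]⟩
  have hsymm : ∀ {X Y : PosWord n}, X ≐ Y → Y ≐ X := by
    intro X Y h
    induction h with
    | refl => exact Relation.ReflTransGen.refl
    | tail _ hs ih =>
      obtain ⟨A, B, u, v, huv, rfl, rfl⟩ := hs
      exact Relation.ReflTransGen.head ⟨A, B, v, u, huv.symm, rfl, rfl⟩ ih
  constructor
  · intro h
    have h' : ConGen.Rel (BandRel n) X Y := PresentedMonoid.mk_eq_mk_iff.1 h
    clear h
    induction h' with
    | of x y hxy =>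
      exact Relation.ReflTransGen.single ⟨1, 1, x, y, Or.inl hxy, by simp, by simp⟩
    | refl x => exact Relation.ReflTransGen.refl
    | symm _ ih => exact hsymm ih
    | trans _ _ ih₁ ih₂ => exact Relation.ReflTransGen.trans ih₁ ih₂
    | mul _ _ ih₁ ih₂ => exact Relation.ReflTransGen.trans (hmulR _ ih₁) (hmulL _ ih₂)
  · intro h
    induction h with
    | refl => rfl
    | tail _ hs ih =>
      rw [ih]
      obtain ⟨A, B, u, v, huv, rfl, rfl⟩ := hs
      have key : PresentedMonoid.mk (BandRel n) u = PresentedMonoid.mk (BandRel n) v := by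
        rcases huv with huv | huv
        · exact PresentedMonoid.mk_eq_mk_of_rel huv
        · exact (PresentedMonoid.mk_eq_mk_of_rel huv).symm
      simp only [map_mul, key]

end BandBraid

open BandBraid

namespace BandBraid

/-! Any two generators have a common right multiple `a · compl a b = b · compl b a`. All the clauses
say that every common right multiple of `a` and `b` factors through this one; since `compl a a` is
empty, this includes cancellation.

This is `hasLcm`, proved by Garside's argument with word reversing: induction on the length, then on
the number of rewriting steps from `aX` to `bY`. The critical step replaces the first letter `a` by
some `c`. Induction on the chain handles the pair `c`, `b`; then `compl c a` and `compl c b` have a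
common multiple in lower degree, which factors through the result of reversing (`HasLcm.reversing`).
What remains is a compatibility of the complements of `a`, `b`, `c`, the cube condition (`cube`). It
depends only on the relative order of at most six subscripts, hence is a finite check. -/

/-! ### Complements, reversing and the finite cube check -/

/-- The word `a_{ts}` of length one, or the empty word when `s < t` fails. -/
def letter {n : ℕ} (t s : Fin n) : List (Gen n) := if h : s < t then [⟨t, s, h⟩] else []

/-- The right complement of `a` by `b`: the word `w` for which `a w` is the least common right
multiple of `a` and `b`. -/
def compl {n : ℕ} (a b : Gen n) : List (Gen n) :=
  if a.t = b.t then
    if b.s < a.s then letter a.s b.s else if a.s < b.s then letter a.t b.s else []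
  else if a.t = b.s then letter b.t a.s
  else if a.s = b.t then letter a.s b.s
  else if a.s = b.s then
    if b.t < a.t then letter a.t b.t else letter b.t a.s
  else if b.s < a.s ∧ a.s < b.t ∧ b.t < a.t then letter a.t b.t ++ letter a.s b.s
  else if a.s < b.s ∧ b.s < a.t ∧ a.t < b.t then letter a.t b.s ++ letter b.t a.s
  -- Only disjoint pairs that do not separate each other are left, and these commute.
  else letter b.t b.s

/-- Right reversing with bounded recursion depth: a result `(p, q)` satisfies `u p = v q`. -/
def reversing {n : ℕ} : ℕ → List (Gen n) → List (Gen n) → Option (List (Gen n) × List (Gen n))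
  | _, [], v => some (v, [])
  | _, u, [] => some ([], u)
  | 0, _, _ => none
  | k + 1, a :: u, b :: v =>
    -- If `u x₁ = (compl a b) x₂` and `v y₁ = (compl b a) x₂ y₂`, then `a u x₁ y₂ = a (compl a b) x₂
    -- y₂ = b (compl b a) x₂ y₂ = b v y₁`.
    (reversing k u (compl a b)).bind fun x =>
      (reversing k v (compl b a ++ x.2)).bind fun y => some (x.1 ++ y.2, y.1)

/-- The cube condition for three generators, tested by reversing. -/
def cubeTest {n : ℕ} (k : ℕ) (a b c : Gen n) : Bool :=
  match reversing k (compl c a) (compl c b) with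
  | none => false
  | some (p, q) =>
    -- An empty first component means that `compl a b` divides the other word on the left, with
    -- quotient `w`. The last reversal asks for the same quotient on the side of `b`.
    match reversing k (compl a c ++ p) (compl a b) with
    | some ([], w) =>
      match reversing k (compl b c ++ q) (compl b a ++ w) with
      | some ([], []) => true
      | _ => false
    | _ => false

/-- All generators on `n` strands. -/
def allGens (n : ℕ) : List (Gen n) :=
  (List.finRange n).flatMap fun t => (List.finRange n).flatMap fun s => letter t s

/-- The strand `i` is a subscript of the generator `a`. -/
def Gen.Uses {n : ℕ} (a : Gen n) (i : Fin n) : Prop := i = a.t ∨ i = a.s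

instance {n : ℕ} (a : Gen n) (i : Fin n) : Decidable (a.Uses i) :=
  inferInstanceAs (Decidable (i = a.t ∨ i = a.s))

/-- The cube condition for all triples of generators that together use every strand. -/
def cubeTestAll (n : ℕ) : Bool :=
  (allGens n).all fun a => (allGens n).all fun b => (allGens n).all fun c =>
    if ∀ i : Fin n, a.Uses i ∨ b.Uses i ∨ c.Uses i then cubeTest 4 a b c else true

theorem mem_allGens {n : ℕ} (a : Gen n) : a ∈ allGens n := by
  simp only [allGens, List.mem_flatMap, List.mem_finRange, true_and]
  exact ⟨a.t, a.s, by simp [letter, a.lt]⟩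

-- Three generators have at most six subscripts, and reversing depth 4 is enough for all of them, so
-- evaluation decides the cube condition.
set_option maxRecDepth 10000 in
theorem cubeTestAll_eq_true : ∀ k ≤ 6, cubeTestAll k = true := by
  decide +kernel

theorem cubeTest_of_uses {k : ℕ} (hk : k ≤ 6) (a b c : Gen k)
    (h : ∀ i : Fin k, a.Uses i ∨ b.Uses i ∨ c.Uses i) : cubeTest 4 a b c = true := by
  have H := cubeTestAll_eq_true k hk
  simp only [cubeTestAll, List.all_eq_true] at H
  have := H a (mem_allGens a) b (mem_allGens b) c (mem_allGens c)
  rwa [if_pos h] at this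

/-! ### Naturality under order embeddings of the strands -/

/-- The generator obtained by relabelling the strands along an order embedding. -/
def Gen.map {k n : ℕ} (φ : Fin k ↪o Fin n) (a : Gen k) : Gen n :=
  ⟨φ a.t, φ a.s, φ.lt_iff_lt.2 a.lt⟩

section Map

variable {k n : ℕ} (φ : Fin k ↪o Fin n)

theorem letter_map (t s : Fin k) : letter (φ t) (φ s) = (letter t s).map (Gen.map φ) := by
  unfold letter
  by_cases h : s < t <;> simp [h, Gen.map]

theorem compl_map (a b : Gen k) :
    compl (a.map φ) (b.map φ) = (compl a b).map (Gen.map φ) := by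
  simp only [compl, Gen.map, φ.lt_iff_lt, φ.injective.eq_iff, letter_map]
  split_ifs <;> simp

theorem reversing_map (m : ℕ) (u v : List (Gen k)) :
    reversing m (u.map (Gen.map φ)) (v.map (Gen.map φ)) =
      (reversing m u v).map (Prod.map (List.map (Gen.map φ)) (List.map (Gen.map φ))) := by
  induction m generalizing u v with
  | zero => cases u <;> cases v <;> simp [reversing]
  | succ m ih =>
    cases u with
    | nil => simp [reversing]
    | cons a u =>
      cases v with
      | nil => simp [reversing]
      | cons b v =>
        simp only [List.map_cons, reversing, compl_map, ih]
        cases reversing m u (compl a b) with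
        | none => rfl
        | some x =>
          simp only [Option.map_some, Option.bind_some, Prod.map, ← List.map_append, ih]
          cases reversing m v (compl b a ++ x.2) with
          | none => rfl
          | some y => simp

/-- The three values of the reversing procedure that establish the cube condition. -/
def Cube (m : ℕ) (a b c : Gen n) : Prop :=
  ∃ p q w : List (Gen n), reversing m (compl c a) (compl c b) = some (p, q) ∧
    reversing m (compl a c ++ p) (compl a b) = some ([], w) ∧
    reversing m (compl b c ++ q) (compl b a ++ w) = some ([], [])

theorem cube_of_cubeTest {m : ℕ} {a b c : Gen n} (h : cubeTest m a b c = true) :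
    Cube m a b c := by
  unfold cubeTest at h
  split at h
  · simp at h
  · next p q h₁ =>
    split at h
    · next w h₂ =>
      split at h
      · next h₃ => exact ⟨p, q, w, h₁, h₂, h₃⟩
      · simp at h
    · simp at h

theorem Cube.map {m : ℕ} {a b c : Gen k} (h : Cube m a b c) :
    Cube m (a.map φ) (b.map φ) (c.map φ) := by
  obtain ⟨p, q, w, h₁, h₂, h₃⟩ := h
  refine ⟨p.map (Gen.map φ), q.map (Gen.map φ), w.map (Gen.map φ), ?_, ?_, ?_⟩
  · simp [compl_map, reversing_map, h₁]
  · simp only [compl_map, ← List.map_append, reversing_map, h₂]; rfl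
  · simp only [compl_map, ← List.map_append, reversing_map, h₃]; rfl

end Map

/-- Complements and reversing see only the order of the subscripts. Relabelling the set `S` of
subscripts in increasing order gives a triple on `S.card ≤ 6` strands that uses every strand, which
is a tested case. -/
theorem cube {n : ℕ} (a b c : Gen n) : Cube 4 a b c := by
  let S : Finset (Fin n) := {a.t, a.s, b.t, b.s, c.t, c.s}
  have hS : S.card ≤ 6 := Finset.card_le_six
  let φ : Fin S.card ↪o Fin n := S.orderEmbOfFin rfl
  have hφ : ∀ x ∈ S, ∃ i, φ i = x := fun x hx => by
    have : x ∈ Set.range φ := by rw [Finset.range_orderEmbOfFin]; exact hx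
    exact this
  have lift : ∀ g : Gen n, g.t ∈ S → g.s ∈ S → ∃ g' : Gen S.card, g'.map φ = g := by
    rintro ⟨t, s, hst⟩ ht hs
    obtain ⟨i, rfl⟩ := hφ t ht
    obtain ⟨j, rfl⟩ := hφ s hs
    exact ⟨⟨i, j, φ.lt_iff_lt.1 hst⟩, rfl⟩
  obtain ⟨a', ha⟩ := lift a (by simp [S]) (by simp [S])
  obtain ⟨b', hb⟩ := lift b (by simp [S]) (by simp [S])
  obtain ⟨c', hc⟩ := lift c (by simp [S]) (by simp [S])
  have H : Cube 4 a' b' c' := by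
    refine cube_of_cubeTest (cubeTest_of_uses hS a' b' c' fun i => ?_)
    have hi : φ i ∈ S := S.orderEmbOfFin_mem rfl i
    simp only [S, ← ha, ← hb, ← hc, Gen.map, Finset.mem_insert, Finset.mem_singleton,
      φ.injective.eq_iff] at hi
    unfold Gen.Uses
    tauto
  rw [← ha, ← hb, ← hc]
  exact H.map φ

/-! ### Least common right multiples in the monoid -/

section Monoid

variable {n : ℕ}

/-- The element of `B_n^+` represented by a list of generators. -/
def val (u : List (Gen n)) : PosBraidMonoid n :=
  PresentedMonoid.mk (BandRel n) (FreeMonoid.ofList u)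

@[simp]
theorem val_nil : val ([] : List (Gen n)) = 1 := rfl

@[simp]
theorem val_append (u v : List (Gen n)) : val (u ++ v) = val u * val v := by
  simp [val, FreeMonoid.ofList_append]

theorem val_cons (a : Gen n) (u : List (Gen n)) : val (a :: u) = val [a] * val u :=
  val_append [a] u

/-! ### Defining relations and values of the complement -/

theorem val_comm {t s r q : Fin n} (hst : s < t) (hqr : q < r)
    (h : 0 < ((t.val : ℤ) - r.val) * ((t.val : ℤ) - q.val) *
      ((s.val : ℤ) - r.val) * ((s.val : ℤ) - q.val)) :
    val [⟨t, s, hst⟩] * val [⟨r, q, hqr⟩] = val [⟨r, q, hqr⟩] * val [⟨t, s, hst⟩] :=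
  PresentedMonoid.mk_eq_mk_of_rel (BandRel.comm t s r q hst hqr h)

theorem val_tri₁₂ {t s r : Fin n} (hst : s < t) (hrs : r < s) :
    val [⟨t, s, hst⟩] * val [⟨s, r, hrs⟩] = val [⟨t, r, hrs.trans hst⟩] * val [⟨t, s, hst⟩] :=
  PresentedMonoid.mk_eq_mk_of_rel (BandRel.tri₁₂ t s r hst hrs)

theorem val_tri₂₃ {t s r : Fin n} (hst : s < t) (hrs : r < s) :
    val [⟨t, r, hrs.trans hst⟩] * val [⟨t, s, hst⟩] =
      val [⟨s, r, hrs⟩] * val [⟨t, r, hrs.trans hst⟩] :=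
  PresentedMonoid.mk_eq_mk_of_rel (BandRel.tri₂₃ t s r hst hrs)

theorem val_tri₁₃ {t s r : Fin n} (hst : s < t) (hrs : r < s) :
    val [⟨t, s, hst⟩] * val [⟨s, r, hrs⟩] = val [⟨s, r, hrs⟩] * val [⟨t, r, hrs.trans hst⟩] :=
  PresentedMonoid.mk_eq_mk_of_rel (BandRel.tri₁₃ t s r hst hrs)

theorem letter_of_lt {t s : Fin n} (h : s < t) : letter t s = [⟨t, s, h⟩] := dif_pos h

/-- For four distinct indices, the sign condition of the commutation relation excludes exactly
the two ways in which the pairs `{s < t}` and `{q < r}` can separate each other. -/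
theorem sign_pos_iff {t s r q : Fin n} (hst : s < t) (hqr : q < r) :
    0 < ((t.val : ℤ) - r.val) * ((t.val : ℤ) - q.val) *
        ((s.val : ℤ) - r.val) * ((s.val : ℤ) - q.val) ↔
      t ≠ r ∧ t ≠ q ∧ s ≠ r ∧ s ≠ q ∧ ¬(q < s ∧ s < r ∧ r < t) ∧ ¬(s < q ∧ q < t ∧ t < r) := by
  obtain ⟨t, ht⟩ := t
  obtain ⟨s, hs⟩ := s
  obtain ⟨r, hr⟩ := r
  obtain ⟨q, hq⟩ := q
  simp only [Fin.mk_lt_mk, ne_eq, Fin.mk.injEq] at *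
  -- The product is grouped by the subscripts `t` and `s`: each group is negative exactly when that
  -- subscript lies strictly between `q` and `r`.
  rw [mul_assoc]
  constructor
  · intro h
    refine ⟨?_, ?_, ?_, ?_, ?_, ?_⟩
    · rintro rfl; simp at h
    · rintro rfl; simp at h
    · rintro rfl; simp at h
    · rintro rfl; simp at h
    · rintro ⟨h₁, h₂, h₃⟩
      refine absurd h (not_lt.2 (mul_nonpos_of_nonneg_of_nonpos
        (mul_nonneg ?_ ?_) (mul_nonpos_of_nonpos_of_nonneg ?_ ?_))) <;> omega
    · rintro ⟨h₁, h₂, h₃⟩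
      refine absurd h (not_lt.2 (mul_nonpos_of_nonpos_of_nonneg
        (mul_nonpos_of_nonpos_of_nonneg ?_ ?_) (mul_nonneg_of_nonpos_of_nonpos ?_ ?_))) <;> omega
  · rintro ⟨h₁, h₂, h₃, h₄, h₅, h₆⟩
    rcases lt_or_gt_of_ne h₁ with h₁ | h₁ <;> rcases lt_or_gt_of_ne h₂ with h₂ | h₂ <;>
      rcases lt_or_gt_of_ne h₃ with h₃ | h₃ <;> rcases lt_or_gt_of_ne h₄ with h₄ | h₄ <;>
      first
      | omega
      | exact mul_pos (mul_pos (by omega) (by omega)) (mul_pos (by omega) (by omega))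
      | exact mul_pos (mul_pos (by omega) (by omega))
          (mul_pos_of_neg_of_neg (by omega) (by omega))
      | exact mul_pos (mul_pos_of_neg_of_neg (by omega) (by omega))
          (mul_pos_of_neg_of_neg (by omega) (by omega))
      | exact mul_pos_of_neg_of_neg (mul_neg_of_neg_of_pos (by omega) (by omega))
          (mul_neg_of_neg_of_pos (by omega) (by omega))

theorem compl_self (a : Gen n) : compl a a = [] := by simp [compl]

theorem compl_of_sign_pos {t s r q : Fin n} (hst : s < t) (hqr : q < r)
    (h : 0 < ((t.val : ℤ) - r.val) * ((t.val : ℤ) - q.val) *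
      ((s.val : ℤ) - r.val) * ((s.val : ℤ) - q.val)) :
    compl ⟨t, s, hst⟩ ⟨r, q, hqr⟩ = [⟨r, q, hqr⟩] := by
  obtain ⟨h₁, h₂, h₃, h₄, h₅, h₆⟩ := (sign_pos_iff hst hqr).1 h
  rw [compl, if_neg h₁, if_neg h₂, if_neg h₃, if_neg h₄, if_neg h₅, if_neg h₆, letter_of_lt hqr]

theorem compl_of_sign_pos' {t s r q : Fin n} (hst : s < t) (hqr : q < r)
    (h : 0 < ((t.val : ℤ) - r.val) * ((t.val : ℤ) - q.val) *
      ((s.val : ℤ) - r.val) * ((s.val : ℤ) - q.val)) :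
    compl ⟨r, q, hqr⟩ ⟨t, s, hst⟩ = [⟨t, s, hst⟩] :=
  compl_of_sign_pos hqr hst (h.trans_eq (by ring))

theorem compl_crossing {t s r q : Fin n} (h₁ : q < s) (h₂ : s < r) (h₃ : r < t) :
    compl ⟨t, s, h₂.trans h₃⟩ ⟨r, q, h₁.trans h₂⟩ = [⟨t, r, h₃⟩, ⟨s, q, h₁⟩] := by
  simp [compl, letter_of_lt, *, h₃.ne', h₂.ne, h₁.ne', (h₁.trans (h₂.trans h₃)).ne']

theorem compl_crossing' {t s r q : Fin n} (h₁ : s < q) (h₂ : q < t) (h₃ : t < r) :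
    compl ⟨t, s, h₁.trans h₂⟩ ⟨r, q, h₂.trans h₃⟩ =
      [⟨t, q, h₂⟩, ⟨r, s, h₁.trans (h₂.trans h₃)⟩] := by
  simp [compl, letter_of_lt, *, h₃.ne, h₂.ne', h₁.ne, (h₁.trans (h₂.trans h₃)).ne,
    h₁.not_gt, h₁.trans (h₂.trans h₃)]

theorem compl_tri₁₂ {t s r : Fin n} (hst : s < t) (hrs : r < s) :
    compl ⟨t, s, hst⟩ ⟨t, r, hrs.trans hst⟩ = [⟨s, r, hrs⟩] := by
  simp [compl, letter_of_lt, hrs]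

theorem compl_tri₂₁ {t s r : Fin n} (hst : s < t) (hrs : r < s) :
    compl ⟨t, r, hrs.trans hst⟩ ⟨t, s, hst⟩ = [⟨t, s, hst⟩] := by
  simp [compl, letter_of_lt, hst, hrs, hrs.not_gt]

theorem compl_tri₂₃ {t s r : Fin n} (hst : s < t) (hrs : r < s) :
    compl ⟨t, r, hrs.trans hst⟩ ⟨s, r, hrs⟩ = [⟨t, s, hst⟩] := by
  simp [compl, letter_of_lt, hst, hst.ne', hrs.ne, (hrs.trans hst).ne']

theorem compl_tri₃₂ {t s r : Fin n} (hst : s < t) (hrs : r < s) :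
    compl ⟨s, r, hrs⟩ ⟨t, r, hrs.trans hst⟩ = [⟨t, r, hrs.trans hst⟩] := by
  simp [compl, letter_of_lt, hst.ne, hrs.ne', (hrs.trans hst).ne, hst.not_gt, hrs.trans hst]

theorem compl_tri₁₃ {t s r : Fin n} (hst : s < t) (hrs : r < s) :
    compl ⟨t, s, hst⟩ ⟨s, r, hrs⟩ = [⟨s, r, hrs⟩] := by
  simp [compl, letter_of_lt, hst.ne', hrs, (hrs.trans hst).ne']

theorem compl_tri₃₁ {t s r : Fin n} (hst : s < t) (hrs : r < s) :
    compl ⟨s, r, hrs⟩ ⟨t, s, hst⟩ = [⟨t, r, hrs.trans hst⟩] := by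
  simp [compl, letter_of_lt, hst.ne, hrs.trans hst]

theorem val_compl_crossing {t s r q : Fin n} (h₁ : q < s) (h₂ : s < r) (h₃ : r < t) :
    val [⟨t, s, h₂.trans h₃⟩] * val [⟨t, r, h₃⟩, ⟨s, q, h₁⟩] =
      val [⟨r, q, h₁.trans h₂⟩] * val [⟨r, s, h₂⟩, ⟨t, q, h₁.trans (h₂.trans h₃)⟩] := by
  have hc := val_comm (h₁.trans (h₂.trans h₃)) h₂
    ((sign_pos_iff (h₁.trans (h₂.trans h₃)) h₂).2
      ⟨h₃.ne', (h₂.trans h₃).ne', (h₁.trans h₂).ne, h₁.ne, fun h => h.1.not_gt h₁,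
        fun h => h.2.2.not_gt h₃⟩)
  -- The left side becomes `a_{tr} a_{rs} a_{sq}` and the right side `a_{tr} a_{rq} a_{rs}`; a
  -- triangle relation identifies them.
  rw [val_cons _ [_], val_cons ⟨r, s, h₂⟩ [_], ← mul_assoc, val_tri₂₃ h₃ h₂, ← val_tri₁₃ h₃ h₂,
    ← hc, ← mul_assoc, ← val_tri₁₃ h₃ (h₁.trans h₂), mul_assoc, mul_assoc, val_tri₁₂ h₂ h₁]

theorem val_compl (a b : Gen n) : val (a :: compl a b) = val (b :: compl b a) := by
  obtain ⟨t, s, hst⟩ := a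
  obtain ⟨r, q, hqr⟩ := b
  rw [val_cons, val_cons ⟨r, q, hqr⟩]
  by_cases h : 0 < ((t.val : ℤ) - r.val) * ((t.val : ℤ) - q.val) *
      ((s.val : ℤ) - r.val) * ((s.val : ℤ) - q.val)
  · rw [compl_of_sign_pos hst hqr h, compl_of_sign_pos' hst hqr h]
    exact val_comm hst hqr h
  rw [sign_pos_iff hst hqr] at h
  by_cases htr : t = r
  · subst htr
    rcases lt_trichotomy q s with h' | rfl | h'
    · rw [compl_tri₁₂ hst h', compl_tri₂₁ hst h', val_tri₁₂]
    · rfl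
    · rw [compl_tri₁₂ hqr h', compl_tri₂₁ hqr h', val_tri₁₂]
  by_cases htq : t = q
  · subst htq
    rw [compl_tri₁₃ hqr hst, compl_tri₃₁ hqr hst, val_tri₁₃]
  by_cases hsr : s = r
  · subst hsr
    rw [compl_tri₁₃ hst hqr, compl_tri₃₁ hst hqr, val_tri₁₃]
  by_cases hsq : s = q
  · subst hsq
    rcases lt_or_gt_of_ne htr with h' | h'
    · rw [compl_tri₂₃ h' hst, compl_tri₃₂ h' hst, val_tri₂₃]
    · rw [compl_tri₂₃ h' hqr, compl_tri₃₂ h' hqr, val_tri₂₃]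
  by_cases hx : q < s ∧ s < r ∧ r < t
  · obtain ⟨h₁, h₂, h₃⟩ := hx
    rw [compl_crossing h₁ h₂ h₃, compl_crossing' h₁ h₂ h₃, val_compl_crossing h₁ h₂ h₃]
  · by_cases hy : s < q ∧ q < t ∧ t < r
    · obtain ⟨h₁, h₂, h₃⟩ := hy
      rw [compl_crossing h₁ h₂ h₃, compl_crossing' h₁ h₂ h₃, val_compl_crossing h₁ h₂ h₃]
    · exact absurd ⟨htr, htq, hsr, hsq, hx, hy⟩ h

/-! ### Reversing and factorization of common multiples -/

/-- Reversing computes common right multiples. -/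
theorem val_reversing {m : ℕ} {u v p q : List (Gen n)} (h : reversing m u v = some (p, q)) :
    val u * val p = val v * val q := by
  induction m generalizing u v p q with
  | zero =>
    cases u <;> cases v <;> simp [reversing] at h <;> obtain ⟨rfl, rfl⟩ := h <;> simp
  | succ m ih =>
    cases u with
    | nil => simp [reversing] at h; obtain ⟨rfl, rfl⟩ := h; simp
    | cons a u =>
      cases v with
      | nil => simp [reversing] at h; obtain ⟨rfl, rfl⟩ := h; simp
      | cons b v =>
        simp only [reversing, Option.bind_eq_some_iff, Option.some.injEq, Prod.mk.injEq] at h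
        obtain ⟨⟨p₁, q₁⟩, h₁, ⟨p₂, q₂⟩, h₂, rfl, rfl⟩ := h
        have e₁ := ih h₁
        have e₂ := ih h₂
        have e := val_compl a b
        rw [val_cons, val_cons b] at e
        simp only [val_append, ← mul_assoc] at e₂ ⊢
        rw [val_cons a, val_cons b, mul_assoc (val [a]), e₁, ← mul_assoc (val [a]), e,
          mul_assoc (val [b]) (val v), e₂]
        simp only [mul_assoc]

/-- The length homomorphism: the defining relations preserve the length of a word. -/
def deg (n : ℕ) : PosBraidMonoid n →* Multiplicative ℕ :=
  PresentedMonoid.lift (fun _ => Multiplicative.ofAdd 1) (by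
    rintro _ _ (_ | _ | _ | _) <;> simp [band])

theorem deg_val_singleton (a : Gen n) : deg n (val [a]) = Multiplicative.ofAdd 1 := rfl

/-- Common right multiples of two generators factor through `compl`, in degree `d + 1`. -/
def HasLcm (n d : ℕ) : Prop :=
  ∀ (a b : Gen n) (X Y : PosBraidMonoid n), (deg n X).toAdd = d → val [a] * X = val [b] * Y →
    ∃ Z, X = val (compl a b) * Z ∧ Y = val (compl b a) * Z

theorem deg_eq_of_mul_eq {a b : Gen n} {X Y : PosBraidMonoid n}
    (h : val [a] * X = val [b] * Y) : (deg n X).toAdd = (deg n Y).toAdd := by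
  have := congrArg (fun x => (deg n x).toAdd) h
  simp only [map_mul, deg_val_singleton, toAdd_mul, toAdd_ofAdd] at this
  omega

/-- Common right multiples of two words factor through the result of reversing. -/
theorem HasLcm.reversing {d : ℕ} (H : ∀ e < d, HasLcm n e) {m : ℕ} {u v p q : List (Gen n)}
    (h : reversing m u v = some (p, q)) {X Y : PosBraidMonoid n}
    (hd : (deg n (val u * X)).toAdd ≤ d) (hXY : val u * X = val v * Y) :
    ∃ Z, X = val p * Z ∧ Y = val q * Z := by
  induction m generalizing u v p q X Y d with
  | zero =>
    cases u <;> cases v <;> simp [BandBraid.reversing] at h <;> obtain ⟨rfl, rfl⟩ := h <;>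
      simp_all
  | succ m ih =>
    cases u with
    | nil => simp [BandBraid.reversing] at h; obtain ⟨rfl, rfl⟩ := h; simp_all
    | cons a u =>
      cases v with
      | nil => simp [BandBraid.reversing] at h; obtain ⟨rfl, rfl⟩ := h; simp_all
      | cons b v =>
        simp only [BandBraid.reversing, Option.bind_eq_some_iff, Option.some.injEq,
          Prod.mk.injEq] at h
        obtain ⟨⟨p₁, q₁⟩, h₁, ⟨p₂, q₂⟩, h₂, rfl, rfl⟩ := h
        rw [val_cons, val_cons b, mul_assoc, mul_assoc] at hXY
        have hdeg := deg_eq_of_mul_eq hXY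
        rw [val_cons, mul_assoc, map_mul, deg_val_singleton, toAdd_mul, toAdd_ofAdd] at hd
        -- Removing the first letter brings the degree strictly below `d`, so `H` applies.
        obtain ⟨Z₁, e₁, e₂⟩ := H _ (by omega) a b _ _ rfl hXY
        obtain ⟨Z₂, rfl, rfl⟩ := ih H h₁ (by omega) e₁
        have e₃ : val v * Y = val (compl b a ++ q₁) * Z₂ := by rw [e₂, val_append, mul_assoc]
        obtain ⟨Z₃, rfl, rfl⟩ := ih H h₂ (by omega) e₃
        exact ⟨Z₃, by simp [mul_assoc], rfl⟩

/-! ### Rewriting chains and least common multiples -/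

/-- Both sides of a defining relation spell out complements of their first letters. -/
theorem BandRel.exists_compl {u v : PosWord n} (h : BandRel n u v) :
    ∃ a b : Gen n, u = FreeMonoid.ofList (a :: compl a b) ∧
      v = FreeMonoid.ofList (b :: compl b a) := by
  cases h with
  | comm t s r q hst hqr h =>
    refine ⟨⟨t, s, hst⟩, ⟨r, q, hqr⟩, ?_, ?_⟩
    · rw [compl_of_sign_pos hst hqr h]; rfl
    · rw [compl_of_sign_pos' hst hqr h]; rfl
  | tri₁₂ t s r hst hrs =>
    exact ⟨⟨t, s, hst⟩, ⟨t, r, hrs.trans hst⟩, by rw [compl_tri₁₂ hst hrs]; rfl,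
      by rw [compl_tri₂₁ hst hrs]; rfl⟩
  | tri₂₃ t s r hst hrs =>
    exact ⟨⟨t, r, hrs.trans hst⟩, ⟨s, r, hrs⟩, by rw [compl_tri₂₃ hst hrs]; rfl,
      by rw [compl_tri₃₂ hst hrs]; rfl⟩
  | tri₁₃ t s r hst hrs =>
    exact ⟨⟨t, s, hst⟩, ⟨s, r, hrs⟩, by rw [compl_tri₁₃ hst hrs]; rfl,
      by rw [compl_tri₃₁ hst hrs]; rfl⟩

/-- A single step on a nonempty word either leaves the first letter alone or replaces it. -/
theorem Step.cases_cons {a : Gen n} {X W : PosWord n} (h : Step (FreeMonoid.of a * X) W) :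
    (∃ X', Step X X' ∧ W = FreeMonoid.of a * X') ∨
    ∃ (c : Gen n) (Q : PosWord n), X = FreeMonoid.ofList (compl a c) * Q ∧
      W = FreeMonoid.of c * (FreeMonoid.ofList (compl c a) * Q) := by
  obtain ⟨P, Q, u, v, huv, h₁, rfl⟩ := h
  cases P using FreeMonoid.casesOn with
  | one =>
    right
    have : ∃ a b : Gen n, u = FreeMonoid.ofList (a :: compl a b) ∧
        v = FreeMonoid.ofList (b :: compl b a) := by
      rcases huv with h | h
      · exact h.exists_compl
      · obtain ⟨a, b, h₁, h₂⟩ := h.exists_compl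
        exact ⟨b, a, h₂, h₁⟩
    obtain ⟨a', c, rfl, rfl⟩ := this
    obtain ⟨rfl, rfl⟩ := List.cons.inj (show a :: X.toList = a' :: (compl a' c ++ Q.toList) from h₁)
    exact ⟨c, Q, rfl, rfl⟩
  | of_mul x P =>
    left
    obtain ⟨rfl, h₂⟩ := List.cons.inj
      (show a :: X.toList = x :: (P * u * Q).toList from h₁)
    exact ⟨P * v * Q, ⟨P, Q, u, v, huv, h₂, rfl⟩, by simp only [mul_assoc]⟩

theorem hasLcm (d : ℕ) : HasLcm n d := by
  induction d using Nat.strong_induction_on with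
  | _ d H =>
  intro a b X Y hd hXY
  obtain ⟨X, rfl⟩ := PresentedMonoid.surjective_mk X
  obtain ⟨Y, rfl⟩ := PresentedMonoid.surjective_mk Y
  have hW : FreeMonoid.of a * X ≐ FreeMonoid.of b * Y := (mk_eq_mk_iff _ _).1 hXY
  clear hXY
  generalize e : FreeMonoid.of a * X = W at hW
  induction hW using Relation.ReflTransGen.head_induction_on generalizing a X with
  | refl =>
    obtain ⟨rfl, rfl⟩ := List.cons.inj (show a :: X.toList = b :: Y.toList from e)
    exact ⟨_, by rw [compl_self, val_nil, one_mul], by rw [compl_self, val_nil, one_mul]; rfl⟩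
  | head h₁ _ ih =>
    subst e
    rcases h₁.cases_cons with ⟨X', hX, rfl⟩ | ⟨c, Q, rfl, rfl⟩
    · have hX' := (mk_eq_mk_iff _ _).2 (Relation.ReflTransGen.single hX)
      rw [hX'] at hd ⊢
      exact ih a X' hd rfl
    · have hac : val [a] * (val (compl a c) * PresentedMonoid.mk (BandRel n) Q) =
          val [c] * (val (compl c a) * PresentedMonoid.mk (BandRel n) Q) := by
        rw [← mul_assoc, ← mul_assoc, ← val_cons, ← val_cons, val_compl]
      have hd' : (deg n (val (compl c a) * PresentedMonoid.mk (BandRel n) Q)).toAdd = d :=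
        (deg_eq_of_mul_eq hac).symm.trans hd
      obtain ⟨Z, e₁, e₂⟩ := ih c (FreeMonoid.ofList (compl c a) * Q) hd' rfl
      obtain ⟨p, q, w, h₁, h₂, h₃⟩ := cube a b c
      -- Both sides of `e₁` have degree `d`, one less than the original word, so the hypothesis
      -- below `d` suffices to factor them.
      obtain ⟨Z', e₃, rfl⟩ := HasLcm.reversing H h₁ hd'.le e₁
      -- The cube condition supplies one `w` with `(compl a c) p = (compl a b) w` and `(compl b c) q
      -- = (compl b a) w`.
      refine ⟨val w * Z', ?_, ?_⟩
      · have := val_reversing h₂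
        rw [val_append, val_nil, mul_one] at this
        rw [map_mul, e₃, ← mul_assoc, ← mul_assoc, ← this]; rfl
      · have := val_reversing h₃
        simp only [val_append, val_nil, mul_one] at this
        rw [e₂, ← mul_assoc, ← mul_assoc, this]

/-! ### Consequences for positive words and cancellation -/

theorem exists_compl_of_equiv {a b : Gen n} {X Y : PosWord n}
    (h : FreeMonoid.of a * X ≐ FreeMonoid.of b * Y) :
    ∃ Z : PosWord n, X ≐ FreeMonoid.ofList (compl a b) * Z ∧
      Y ≐ FreeMonoid.ofList (compl b a) * Z := by
  obtain ⟨Z, h₁, h₂⟩ := hasLcm _ a b (PresentedMonoid.mk _ X) (PresentedMonoid.mk _ Y) rfl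
    ((mk_eq_mk_iff _ _).2 h)
  obtain ⟨Z, rfl⟩ := PresentedMonoid.surjective_mk Z
  exact ⟨Z, (mk_eq_mk_iff _ _).1 h₁, (mk_eq_mk_iff _ _).1 h₂⟩

theorem mul_left_cancel_of_val (P : PosWord n) {X Y : PosBraidMonoid n}
    (h : PresentedMonoid.mk (BandRel n) P * X = PresentedMonoid.mk (BandRel n) P * Y) : X = Y := by
  induction P using FreeMonoid.inductionOn' with
  | one => simpa using h
  | of_mul a P ih =>
    rw [map_mul, mul_assoc, mul_assoc] at h
    obtain ⟨Z, h₁, h₂⟩ := hasLcm _ a a _ _ rfl h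
    -- Both tails equal `val (compl a a) * Z` with the same `Z`.
    exact ih (h₁.trans h₂.symm)

/-- For separating pairs, `compl` may list its two commuting letters in the order opposite to that
of the theorem; this reconciles them. -/
theorem val_swap {t s r q : Fin n} (h₁ : q < s) (h₂ : s < r) (h₃ : r < t) :
    val [⟨r, s, h₂⟩, ⟨t, q, h₁.trans (h₂.trans h₃)⟩] =
      val [⟨t, q, h₁.trans (h₂.trans h₃)⟩, ⟨r, s, h₂⟩] := by
  rw [val_cons, val_cons ⟨t, q, _⟩]
  exact (val_comm (h₁.trans (h₂.trans h₃)) h₂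
    ((sign_pos_iff (h₁.trans (h₂.trans h₃)) h₂).2
      ⟨h₃.ne', (h₂.trans h₃).ne', (h₁.trans h₂).ne, h₁.ne, fun h => h.1.not_gt h₁,
        fun h => h.2.2.not_gt h₃⟩)).symm

end Monoid

end BandBraid

theorem mainTheorem6 (n : ℕ) :
    (∀ (t s r q : Fin n) (hst : s < t) (hqr : q < r) (X Y : PosWord n),
      band t s hst * X ≐ band r q hqr * Y →
      -- (I) two distinct indices
      (t = r → s = q → X ≐ Y) ∧
      -- (II) three distinct indices
      (∀ (_ : t = r) (h : q < s),
        ∃ Z : PosWord n, X ≐ band s q h * Z ∧ Y ≐ band t s hst * Z) ∧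
      (∀ (e : t = r) (h : s < q),
        ∃ Z : PosWord n, X ≐ band t q (hqr.trans_eq e.symm) * Z ∧ Y ≐ band q s h * Z) ∧
      (∀ (e : t = q),
        ∃ Z : PosWord n, X ≐ band r s (hst.trans (e.trans_lt hqr)) * Z ∧ Y ≐ band t s hst * Z) ∧
      (∀ (e : s = r),
        ∃ Z : PosWord n, X ≐ band s q (hqr.trans_eq e.symm) * Z ∧
          Y ≐ band t q ((hqr.trans_eq e.symm).trans hst) * Z) ∧
      (∀ (_ : s = q) (h : r < t),
        ∃ Z : PosWord n, X ≐ band t r h * Z ∧ Y ≐ band t s hst * Z) ∧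
      (∀ (e : s = q) (h : t < r),
        ∃ Z : PosWord n, X ≐ band r s (e.trans_lt hqr) * Z ∧ Y ≐ band r t h * Z) ∧
      -- (III) four distinct indices, pairs that do not separate each other
      (0 < ((t.val : ℤ) - r.val) * ((t.val : ℤ) - q.val) *
          ((s.val : ℤ) - r.val) * ((s.val : ℤ) - q.val) →
        ∃ Z : PosWord n, X ≐ band r q hqr * Z ∧ Y ≐ band t s hst * Z) ∧
      -- (IV) four distinct indices, pairs that separate each other
      (∀ (h₁ : q < s) (h₂ : s < r) (h₃ : r < t),
        ∃ Z : PosWord n, X ≐ band t r h₃ * band s q h₁ * Z ∧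
          Y ≐ band t q (h₁.trans hst) * band r s h₂ * Z) ∧
      (∀ (h₁ : s < q) (h₂ : q < t) (h₃ : t < r),
        ∃ Z : PosWord n, X ≐ band t q h₂ * band r s (hst.trans h₃) * Z ∧
          Y ≐ band r t h₃ * band q s h₁ * Z)) ∧
    -- left cancellation in the monoid of positive braids
    IsLeftCancelMul (PosBraidMonoid n) := by
  refine ⟨fun t s r q hst hqr X Y h => ?_, ⟨fun P X Y h => ?_⟩⟩
  · obtain ⟨Z, hX, hY⟩ := exists_compl_of_equiv h
    refine ⟨?_, ?_, ?_, ?_, ?_, ?_, ?_, ?_, ?_, ?_⟩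
    · rintro rfl rfl
      rw [compl_self] at hX hY
      exact (mk_eq_mk_iff _ _).1
        (((mk_eq_mk_iff _ _).2 hX).trans ((mk_eq_mk_iff _ _).2 hY).symm)
    · rintro rfl h'
      rw [compl_tri₁₂ hst h'] at hX
      rw [compl_tri₂₁ hst h'] at hY
      exact ⟨Z, hX, hY⟩
    · rintro rfl h'
      rw [compl_tri₂₁ hqr h'] at hX
      rw [compl_tri₁₂ hqr h'] at hY
      exact ⟨Z, hX, hY⟩
    · rintro rfl
      rw [compl_tri₃₁ hqr hst] at hX
      rw [compl_tri₁₃ hqr hst] at hY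
      exact ⟨Z, hX, hY⟩
    · rintro rfl
      rw [compl_tri₁₃ hst hqr] at hX
      rw [compl_tri₃₁ hst hqr] at hY
      exact ⟨Z, hX, hY⟩
    · rintro rfl h'
      rw [compl_tri₂₃ h' hqr] at hX
      rw [compl_tri₃₂ h' hqr] at hY
      exact ⟨Z, hX, hY⟩
    · rintro rfl h'
      rw [compl_tri₃₂ h' hst] at hX
      rw [compl_tri₂₃ h' hst] at hY
      exact ⟨Z, hX, hY⟩
    · intro h'
      rw [compl_of_sign_pos hst hqr h'] at hX
      rw [compl_of_sign_pos' hst hqr h'] at hY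
      exact ⟨Z, hX, hY⟩
    · intro h₁ h₂ h₃
      rw [compl_crossing h₁ h₂ h₃] at hX
      rw [compl_crossing' h₁ h₂ h₃] at hY
      refine ⟨Z, hX, (mk_eq_mk_iff _ _).1 (((mk_eq_mk_iff _ _).2 hY).trans ?_)⟩
      rw [map_mul, map_mul]
      exact congrArg (· * _) (val_swap h₁ h₂ h₃)
    · intro h₁ h₂ h₃
      rw [compl_crossing' h₁ h₂ h₃] at hX
      rw [compl_crossing h₁ h₂ h₃] at hY
      exact ⟨Z, hX, hY⟩
  · obtain ⟨P, rfl⟩ := PresentedMonoid.surjective_mk P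
    exact mul_left_cancel_of_val P h
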